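/- Let $G$ be a group with a homomorphism $s\colon G\to\{1,-1\}$; $g\in G$ is called unitary if $s(g)=1$ and anti-unitary if $s(g)=-1$. Put $V=\mathbb C^d$ with its standard Hermitian inner product, and let $\kappa_{1}=\mathrm{id}_V$ and $\kappa_{-1}=\kappa$, the entrywise complex conjugation. Let $\omega\colon G\times G\to U(1)$ be a factor system, that is, $\omega(g_1,g_2)\,\omega(g_1g_2,g_3)=\omega(g_2,g_3)^{s(g_1)}\,\omega(g_1,g_2g_3)$ for all $g_1,g_2,g_3\in G$. Let $M$ be a $d$-dimensional unitary projective co-representation of $G$ with factor system $\omega$: each $M(g)$, $g\in G$, is a unitary $d\times d$ matrix, and $$M(g_1)\kappa_{s(g_1)}\,M(g_2)\kappa_{s(g_2)}=\omega(g_1,g_2)\,M(g_1g_2)\kappa_{s(g_1g_2)}\qquad(g_1,g_2\in G).$$ A complex subspace of $V$ is invariant if every operator $M(g)\kappa_{s(g)}$ maps it into itself, and it is an irreducible component if it is nonzero, invariant, and contains no invariant complex subspace other than $0$ and itself. Let $\mathscr Q$ be the real vector space of all Hermitian $d\times d$ matrices that commute, as operators on $V$, with every $M(g)\kappa_{s(g)}$,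 and let $Q_1,\dots,Q_m$ be a basis of $\mathscr Q$ over $\mathbb R$. Let $r_1,\dots,r_m$ be real random variables on a probability space whose joint law is absolutely continuous with respect to Lebesgue measure on $\mathbb R^m$, and let $$Q_r=\sum_{l=1}^m r_l\,Q_l .$$ **Theorem.** Almost surely, the eigenspaces of $Q_r$ are irreducible components, they are pairwise orthogonal, and $V$ is their direct sum. Moreover, almost surely, the orthogonal projectors onto the eigenspaces of $Q_r$ (one for each distinct eigenvalue) commute with every $M(g)\kappa_{s(g)}$, have pairwise products $0$, and add up to the identity. -/

import Mathlib

open MeasureTheory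

noncomputable section

namespace Corep

/-- The carrier space `ℂ^d` with its standard Hermitian inner product. -/
abbrev Carrier (d : ℕ) : Type := EuclideanSpace ℂ (Fin d)

/-- Entrywise complex conjugation on `ℂ^d`; it is antilinear, hence only real-linear. -/
def conjugation (d : ℕ) : Carrier d →ₗ[ℝ] Carrier d where
  toFun v := WithLp.toLp 2 fun i => star (v i)
  map_add' v w := by
    ext i
    simp
  map_smul' c v := by
    ext i
    simp

/-- `κ_ε`: the identity for the sign `ε = 1`, complex conjugation for the sign `ε = -1`. -/
def kappa (d : ℕ) (ε : ℤˣ) : Carrier d →ₗ[ℝ] Carrier d :=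
  if ε = 1 then LinearMap.id else conjugation d

/-- The real-linear operator on `ℂ^d` defined by a complex matrix. -/
def matOp {d : ℕ} (A : Matrix (Fin d) (Fin d) ℂ) : Carrier d →ₗ[ℝ] Carrier d :=
  (Matrix.toEuclideanLin A).restrictScalars ℝ

variable {G : Type*} [Group G]

/-- A `U(1)`-valued factor system of a group `G` whose elements are marked as unitary
(`s g = 1`) or anti-unitary (`s g = -1`) by a homomorphism `s`. -/
structure FactorSystem (s : G →* ℤˣ) where
  /-- the factors `ω(g₁, g₂)` -/
  ω : G → G → Circle
  cocycle : ∀ g₁ g₂ g₃ : G,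
    ω g₁ g₂ * ω (g₁ * g₂) g₃ = ω g₂ g₃ ^ ((s g₁ : ℤˣ) : ℤ) * ω g₁ (g₂ * g₃)

/-- A `d`-dimensional unitary projective co-representation with factor system `ω`: unitary
matrices `M(g)` with `M(g₁)κ_{s(g₁)} M(g₂)κ_{s(g₂)} = ω(g₁, g₂) M(g₁g₂)κ_{s(g₁g₂)}`. -/
structure ProjCorep (s : G →* ℤˣ) (ω : FactorSystem s) (d : ℕ) where
  /-- the matrices `M(g)` -/
  M : G → Matrix.unitaryGroup (Fin d) ℂ
  mul_rel : ∀ (g₁ g₂ : G) (v : Carrier d),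
    matOp (M g₁).1 (kappa d (s g₁) (matOp (M g₂).1 (kappa d (s g₂) v))) =
      (ω.ω g₁ g₂ : ℂ) • matOp (M (g₁ * g₂)).1 (kappa d (s (g₁ * g₂)) v)

namespace ProjCorep

variable {s : G →* ℤˣ} {ω : FactorSystem s} {d : ℕ}

/-- The operator `M(g)κ_{s(g)}` on the carrier space. -/
def op (R : ProjCorep s ω d) (g : G) : Carrier d →ₗ[ℝ] Carrier d :=
  matOp (R.M g).1 ∘ₗ kappa d (s g)

/-- The real vector space of all Hermitian matrices that commute with every `M(g)κ_{s(g)}`. -/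
def hermitianCentralizer (R : ProjCorep s ω d) : Submodule ℝ (Matrix (Fin d) (Fin d) ℂ) where
  carrier := {Q | Q.IsHermitian ∧ ∀ g, matOp Q ∘ₗ R.op g = R.op g ∘ₗ matOp Q}
  zero_mem' := by
    refine ⟨Matrix.isHermitian_zero, fun g => ?_⟩
    ext1 v
    simp [matOp]
  add_mem' := by
    rintro A B ⟨hA, hA'⟩ ⟨hB, hB'⟩
    refine ⟨hA.add hB, fun g => ?_⟩
    have h : matOp (A + B) = matOp A + matOp B := by
      ext1 v
      simp [matOp]
    rw [h, LinearMap.add_comp, LinearMap.comp_add, hA', hB']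
  smul_mem' := by
    rintro c A ⟨hA, hA'⟩
    refine ⟨?_, fun g => ?_⟩
    · simp [Matrix.IsHermitian, Matrix.conjTranspose_smul, hA.eq]
    · have h : matOp (c • A) = c • matOp A := by
        have hc : c • A = (c : ℂ) • A := by
          ext i j
          simp
        ext1 v
        have e := congrArg (fun f => f v) (map_smul Matrix.toEuclideanLin (c : ℂ) A)
        rw [← hc] at e
        simpa [matOp] using e
      rw [h, LinearMap.smul_comp, LinearMap.comp_smul, hA']

/-- A complex subspace is invariant if every `M(g)κ_{s(g)}` maps it into itself. -/
def IsInvariant (R : ProjCorep s ω d) (W : Submodule ℂ (Carrier d)) : Prop :=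
  ∀ g, ∀ v ∈ W, R.op g v ∈ W

/-- A complex subspace is an irreducible component if it is nonzero, invariant, and has no
invariant complex subspaces other than `0` and itself. -/
def IsIrreducibleComponent (R : ProjCorep s ω d) (W : Submodule ℂ (Carrier d)) : Prop :=
  W ≠ ⊥ ∧ R.IsInvariant W ∧
    ∀ U : Submodule ℂ (Carrier d), U ≤ W → R.IsInvariant U → U = ⊥ ∨ U = W

end ProjCorep

/-- The type of eigenvalues of a complex matrix. -/
abbrev Eigenvalue {d : ℕ} (A : Matrix (Fin d) (Fin d) ℂ) : Type :=
  Module.End.Eigenvalues (Matrix.toEuclideanLin A)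

/-- The eigenspace in `ℂ^d` of a complex matrix for one of its eigenvalues. -/
def eigenspace {d : ℕ} (A : Matrix (Fin d) (Fin d) ℂ) (z : Eigenvalue A) :
    Submodule ℂ (Carrier d) :=
  Module.End.eigenspace (Matrix.toEuclideanLin A) (z : ℂ)

/-- The orthogonal projector of `ℂ^d` onto an eigenspace of a complex matrix. -/
def eigenprojector {d : ℕ} (A : Matrix (Fin d) (Fin d) ℂ) (z : Eigenvalue A) :
    Carrier d →L[ℂ] Carrier d :=
  (eigenspace A z).starProjection

end Corep

end

/-!
A Hermitian operator has as many distinct eigenvalues as its minimal polynomial has degree. Let `B`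
be an element of the commutant for which this degree is maximal. Along every line in the direction
of `B` some minor of the powers is an analytic function that does not vanish identically, so the
degree is maximal off a discrete set, and by Fubini it is maximal for almost every element `A` of
the commutant. Suppose now that an eigenspace of `A` properly contained a nonzero invariant subspace
`U`. A real-linear isometry that maps `U` onto itself preserves the nearest points of `U`, so the
orthogonal projection onto `U` lies in the commutant; adding a suitable multiple of it to `A` splits
the eigenvalue and increases the degree, a contradiction.
-/

section Splitting

open Polynomial

variable {K A : Type*}

theorem aeval_mul_eq_aeval_mul [CommSemiring K] [Semiring A] [Algebra K A] {a c x : A}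
    (hax : Commute a x) (hcx : c * x = a * x) (q : K[X]) : aeval c q * x = aeval a q * x := by
  have hpow (n : ℕ) : c ^ n * x = a ^ n * x := by
    induction n with
    | zero => simp
    | succ n ih =>
      rw [pow_succ, mul_assoc, hcx, hax.eq, ← mul_assoc, ih, mul_assoc, ← hax.eq, ← mul_assoc,
        ← pow_succ]
  simp only [aeval_eq_sum_range, Finset.sum_mul, smul_mul_assoc, hpow]

theorem aeval_mul_eq_eval_smul [CommSemiring K] [Semiring A] [Algebra K A] {a x : A} {μ : K}
    (h : a * x = μ • x) (q : K[X]) : aeval a q * x = q.eval μ • x := by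
  rw [aeval_mul_eq_aeval_mul (Algebra.commutes μ x) (by rw [h, Algebra.smul_def]),
    aeval_algebraMap_apply_eq_algebraMap_eval, Algebra.smul_def]

variable [Field K] [Ring A] [Algebra K A]

theorem isRoot_minpoly_of_mul_eq_smul {c x : A} {ξ : K} (hx : x ≠ 0) (h : c * x = ξ • x) :
    (minpoly K c).IsRoot ξ := by
  have hzero : (minpoly K c).eval ξ • x = 0 := by
    rw [← aeval_mul_eq_eval_smul h, minpoly.aeval, zero_mul]
  exact (smul_eq_zero.1 hzero).resolve_right hx

theorem exists_natDegree_minpoly_lt_add_smul [Infinite K] [Algebra.IsIntegral K A] {a p b : A}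
    {μ : K} (hp : IsIdempotentElem p) (hp0 : p ≠ 0) (hap : a * p = μ • p) (hpa : p * a = μ • p)
    (hb0 : b ≠ 0) (hab : a * b = μ • b) (hpb : p * b = 0) :
    ∃ ε : K, (minpoly K a).natDegree < (minpoly K (a + ε • p)).natDegree := by
  -- Choose `ε` so that `p` moves to an eigenvalue `ν` off the spectrum of `a`. As `b` keeps the
  -- eigenvalue `μ`, the new minimal polynomial still annihilates `a` and has the extra root `ν`.
  have minpoly_ne_zero (x : A) : minpoly K x ≠ 0 :=
    minpoly.ne_zero (Algebra.IsIntegral.isIntegral x)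
  obtain ⟨ν, hν⟩ : ∃ ν, (minpoly K a).eval ν ≠ 0 := by
    by_contra! h
    exact minpoly_ne_zero a (Polynomial.funext fun ν => by rw [h, eval_zero])
  refine ⟨ν - μ, ?_⟩
  set c := a + (ν - μ) • p with hc
  have hcν : (minpoly K c).IsRoot ν := isRoot_minpoly_of_mul_eq_smul hp0 (by
    rw [hc, add_mul, hap, smul_mul_assoc, hp.eq, ← add_smul, add_sub_cancel])
  have hcμ : (minpoly K c).IsRoot μ := isRoot_minpoly_of_mul_eq_smul hb0 (by
    rw [hc, add_mul, hab, smul_mul_assoc, hpb, smul_zero, add_zero])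
  have hca : aeval a (minpoly K c) = 0 := by
    have hcompl : aeval a (minpoly K c) * (1 - p) = 0 := by
      have hcomm : Commute a (1 - p) := (Commute.one_right a).sub_right (hap.trans hpa.symm)
      have hagree : c * (1 - p) = a * (1 - p) := by
        rw [hc, add_mul, smul_mul_assoc, hp.mul_one_sub_self, smul_zero, add_zero]
      rw [← aeval_mul_eq_aeval_mul hcomm hagree, minpoly.aeval, zero_mul]
    calc aeval a (minpoly K c)
        = aeval a (minpoly K c) * p + aeval a (minpoly K c) * (1 - p) := by
          rw [← mul_add, add_sub_cancel, mul_one]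
      _ = 0 := by rw [hcompl, aeval_mul_eq_eval_smul hap, hcμ.eq_zero, zero_smul, add_zero]
  obtain ⟨g, hg⟩ := minpoly.dvd K a hca
  have hg0 : g ≠ 0 := right_ne_zero_of_mul (hg ▸ minpoly_ne_zero c)
  have hgν : g.IsRoot ν := by
    rw [hg, IsRoot.def, eval_mul] at hcν
    exact (mul_eq_zero.1 hcν).resolve_left hν
  rw [hg, natDegree_mul (minpoly_ne_zero a) hg0]
  exact Nat.lt_add_of_pos_right (natDegree_pos_iff_degree_pos.2 (degree_pos_of_root hg0 hgν))

end Splitting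

section Generic

open Filter Topology Module

variable {𝕜 A : Type*}

theorem eventually_codiscrete_linearIndependent [NontriviallyNormedField 𝕜] [CompleteSpace 𝕜]
    [ConnectedSpace 𝕜] {ι F : Type*} [Finite ι] [NormedAddCommGroup F] [NormedSpace 𝕜 F]
    [FiniteDimensional 𝕜 F] {v : 𝕜 → ι → F}
    (hv : ∀ i, AnalyticOnNhd 𝕜 (fun t => v t i) Set.univ) {t₀ : 𝕜}
    (ht₀ : LinearIndependent 𝕜 (v t₀)) :
    ∀ᶠ t in codiscrete 𝕜, LinearIndependent 𝕜 (v t) := by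
  classical
  have := Fintype.ofFinite ι
  obtain ⟨φ, hφ⟩ := (Fintype.linearCombination 𝕜 (v t₀)).exists_leftInverse_of_injective
    (LinearMap.ker_eq_bot.2 (linearIndependent_iff_injective_fintypeLinearCombination.1 ht₀))
  let minor (t : 𝕜) : Matrix ι ι 𝕜 := .of fun i j => φ (v t i) j
  have minor_t₀ : minor t₀ = 1 := by
    ext i j
    have h := congr_fun (LinearMap.congr_fun hφ (Pi.single i 1)) j
    simpa [minor, Fintype.linearCombination_apply_single, Matrix.one_apply, Pi.single_apply,
      eq_comm] using h
  have hentry (i j : ι) : AnalyticOnNhd 𝕜 (fun t => minor t i j) Set.univ := fun t ht =>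
    ((LinearMap.toContinuousLinearMap ((LinearMap.proj j : (ι → 𝕜) →ₗ[𝕜] 𝕜) ∘ₗ φ)).analyticAt
      (v t i)).comp (f := fun t => v t i) (hv i t ht)
  have hdet : AnalyticOnNhd 𝕜 (fun t => (minor t).det) Set.univ := by
    simp only [Matrix.det_apply']
    exact Finset.univ.analyticOnNhd_fun_sum fun σ _ =>
      analyticOnNhd_const.mul (Finset.univ.analyticOnNhd_fun_prod fun i _ => hentry _ _)
  filter_upwards [hdet.preimage_zero_mem_codiscrete (x := t₀) (by simp [minor_t₀])] with t ht
  exact .of_comp φ (Matrix.linearIndependent_rows_of_det_ne_zero (A := minor t) ht)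

theorem exists_linearIndependent_pow_add_smul [NontriviallyNormedField 𝕜] [CompleteSpace 𝕜]
    [NormedRing A] [NormedAlgebra 𝕜 A] (a : A) {b : A} {k : ℕ}
    (hb : LinearIndependent 𝕜 fun i : Fin k => b ^ (i : ℕ)) :
    ∃ t : 𝕜, LinearIndependent 𝕜 fun i : Fin k => (a + t • b) ^ (i : ℕ) := by
  -- Up to the factor `s⁻¹`, the element `a + s⁻¹ • b` is a small perturbation of `b`.
  have hcont : Continuous fun (s : 𝕜) (i : Fin k) => (s • a + b) ^ (i : ℕ) := by fun_prop
  have hnear : ∀ᶠ s : 𝕜 in 𝓝 0, LinearIndependent 𝕜 fun i : Fin k => (s • a + b) ^ (i : ℕ) :=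
    hcont.continuousAt.eventually (LinearIndependent.eventually (by simpa using hb))
  obtain ⟨s, hs, hs0 : s ≠ 0⟩ := ((hnear.filter_mono nhdsWithin_le_nhds).and
    (self_mem_nhdsWithin (s := {0}ᶜ))).exists
  refine ⟨s⁻¹, ?_⟩
  convert hs.units_smul fun i => (Units.mk0 s hs0)⁻¹ ^ (i : ℕ) using 2 with i
  rw [Pi.smul_apply', Units.smul_def, Units.val_pow_eq_pow_val, Units.val_inv_eq_inv_val,
    Units.val_mk0, ← smul_pow, smul_add, inv_smul_smul₀ hs0]

theorem le_natDegree_minpoly_of_linearIndependent_pow [CommRing 𝕜] [Nontrivial 𝕜]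
    [Ring A] [Algebra 𝕜 A] {x : A} (hx : IsIntegral 𝕜 x) {k : ℕ}
    (h : LinearIndependent 𝕜 fun i : Fin k => x ^ (i : ℕ)) :
    k ≤ (minpoly 𝕜 x).natDegree := by
  by_contra! hlt
  have hsum : ∑ i : Fin k, (minpoly 𝕜 x).coeff i • x ^ (i : ℕ) = 0 := by
    rw [Fin.sum_univ_eq_sum_range (fun i => (minpoly 𝕜 x).coeff i • x ^ i),
      ← Polynomial.aeval_eq_sum_range' hlt, minpoly.aeval]
  exact (minpoly.monic hx).ne_zero
    (Polynomial.leadingCoeff_eq_zero.1 (Fintype.linearIndependent_iff.1 h _ hsum ⟨_, hlt⟩))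

variable [NormedRing A] [NormedAlgebra ℝ A] [FiniteDimensional ℝ A]

theorem ae_linearIndependent_pow_add_smul (a : A) {b : A} {k : ℕ}
    (hb : LinearIndependent ℝ fun i : Fin k => b ^ (i : ℕ)) :
    ∀ᵐ t : ℝ, LinearIndependent ℝ fun i : Fin k => (a + t • b) ^ (i : ℕ) := by
  obtain ⟨t₀, ht₀⟩ := exists_linearIndependent_pow_add_smul a hb
  have hanalytic (i : Fin k) : AnalyticOnNhd ℝ (fun t : ℝ => (a + t • b) ^ (i : ℕ)) Set.univ :=
    fun t _ => by fun_prop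
  rw [← Measure.restrict_univ (μ := volume)]
  exact ae_restrict_le_codiscreteWithin MeasurableSet.univ
    (eventually_codiscrete_linearIndependent hanalytic ht₀)

variable {V : Type*} [NormedAddCommGroup V] [NormedSpace ℝ V] [FiniteDimensional ℝ V]
  [MeasurableSpace V] [BorelSpace V] (μ : Measure V) [μ.IsAddHaarMeasure]

theorem ae_linearIndependent_pow (L : V →ₗ[ℝ] A) {v₀ : V} {k : ℕ}
    (h : LinearIndependent ℝ fun i : Fin k => L v₀ ^ (i : ℕ)) :
    ∀ᵐ v ∂μ, LinearIndependent ℝ fun i : Fin k => L v ^ (i : ℕ) := by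
  have hcont : Continuous fun (v : V) (i : Fin k) => L v ^ (i : ℕ) :=
    continuous_pi fun i => L.continuous_of_finiteDimensional.pow i
  let independent : Set V := {v | LinearIndependent ℝ fun i : Fin k => L v ^ (i : ℕ)}
  have hmeas : MeasurableSet independent :=
    (isOpen_setOfPred_linearIndependent.preimage hcont).measurableSet
  change ∀ᵐ v ∂μ, v ∈ independent
  refine ae_mem_of_ae_add_linearMap_mem (LinearMap.toSpanSingleton ℝ V v₀) volume μ hmeas
    fun v => ?_
  simpa only [independent, Set.mem_ofPred_eq, LinearMap.toSpanSingleton_apply, map_add, map_smul]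
    using ae_linearIndependent_pow_add_smul (L v) h

theorem ae_forall_natDegree_minpoly_le (L : V →ₗ[ℝ] A) :
    ∀ᵐ v ∂μ, ∀ w, (minpoly ℝ (L w)).natDegree ≤ (minpoly ℝ (L v)).natDegree := by
  have hbdd : BddAbove (Set.range fun w => (minpoly ℝ (L w)).natDegree) :=
    ⟨finrank ℝ A, Set.forall_mem_range.2 fun w => minpoly.natDegree_le (L w)⟩
  obtain ⟨v₀, hv₀⟩ := Nat.sSup_mem (Set.range_nonempty _) hbdd
  filter_upwards [ae_linearIndependent_pow μ L (linearIndependent_pow (L v₀))] with v hv w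
  calc (minpoly ℝ (L w)).natDegree ≤ (minpoly ℝ (L v₀)).natDegree :=
        (le_csSup hbdd ⟨w, rfl⟩).trans_eq hv₀.symm
    _ ≤ (minpoly ℝ (L v)).natDegree :=
        le_natDegree_minpoly_of_linearIndependent_pow (Algebra.IsIntegral.isIntegral _) hv

end Generic

section Isometries

open Module.End

variable {𝕜 E : Type*} [RCLike 𝕜] [NormedAddCommGroup E] [InnerProductSpace 𝕜 E]
  [NormedSpace ℝ E] [IsScalarTower ℝ 𝕜 E]

theorem starProjection_map_of_forall_mem (f : E →ₗᵢ[ℝ] E) {U : Submodule 𝕜 E}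
    [FiniteDimensional 𝕜 U] (hU : ∀ v ∈ U, f v ∈ U) (v : E) :
    U.starProjection (f v) = f (U.starProjection v) := by
  have : FiniteDimensional ℝ (U.restrictScalars ℝ) := FiniteDimensional.trans ℝ 𝕜 U
  let g : U.restrictScalars ℝ →ₗ[ℝ] U.restrictScalars ℝ := f.toLinearMap.restrict hU
  have hg : Function.Surjective g := LinearMap.injective_iff_surjective.1 fun a b hab =>
    Subtype.ext (f.injective (congrArg Subtype.val hab))
  have hmem : f (U.starProjection v) ∈ U := hU _ (U.starProjection_apply_mem v)
  refine Submodule.eq_starProjection_of_mem_of_inner_eq_zero hmem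
    ((U.norm_eq_iInf_iff_inner_eq_zero hmem).1 ?_)
  calc ‖f v - f (U.starProjection v)‖ = ‖v - U.starProjection v‖ := by rw [← map_sub, f.norm_map]
    _ = ⨅ w : U, ‖v - w‖ := U.starProjection_minimal v
    _ = ⨅ w : U, ‖f v - w‖ := hg.iInf_congr _ fun w => by
        rw [show ((g w : U.restrictScalars ℝ) : E) = f w from rfl, ← map_sub, f.norm_map]

variable {ι : Type*}

/-- Subspaces mapped into themselves by every member of a family of real-linear isometries. -/
def IsInvariantUnder (f : ι → E →ₗᵢ[ℝ] E) (U : Submodule 𝕜 E) : Prop :=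
  ∀ i, ∀ v ∈ U, f i v ∈ U

/-- The irreducible components of a family of real-linear isometries: the minimal nonzero invariant
`𝕜`-subspaces. -/
def IsIrreducibleUnder (f : ι → E →ₗᵢ[ℝ] E) (W : Submodule 𝕜 E) : Prop :=
  Minimal (fun U => U ≠ ⊥ ∧ IsInvariantUnder f U) W

variable (𝕜) in
/-- The symmetric operators commuting with a family of real-linear isometries. They form only a real
vector space, even for isometries that are `𝕜`-linear. -/
def symmetricCommutant (f : ι → E →ₗᵢ[ℝ] E) : Submodule ℝ (E →L[𝕜] E) where
  carrier := {T | (T : E →ₗ[𝕜] E).IsSymmetric ∧ ∀ i v, T (f i v) = f i (T v)}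
  zero_mem' := ⟨LinearMap.IsSymmetric.zero, fun i v => by simp⟩
  add_mem' hS hT := ⟨hS.1.add hT.1, fun i v => by simp [hS.2, hT.2]⟩
  smul_mem' c T hT := by
    refine ⟨?_, fun i v => by simp [hT.2]⟩
    rw [RCLike.real_smul_eq_coe_smul (K := 𝕜) c T]
    exact hT.1.smul (RCLike.conj_ofReal c)

variable {f : ι → E →ₗᵢ[ℝ] E} {A : E →L[𝕜] E}

theorem IsInvariantUnder.starProjection_mem_symmetricCommutant {U : Submodule 𝕜 E}
    [FiniteDimensional 𝕜 U] (hU : IsInvariantUnder f U) :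
    U.starProjection ∈ symmetricCommutant 𝕜 f :=
  ⟨U.starProjection_isSymmetric, fun i v => starProjection_map_of_forall_mem (f i) (hU i) v⟩

theorem mem_eigenspace_iff_eq_re_smul (hA : (A : E →ₗ[𝕜] E).IsSymmetric)
    (z : Eigenvalues (A : E →ₗ[𝕜] E)) {v : E} :
    v ∈ eigenspace (A : E →ₗ[𝕜] E) z ↔ A v = RCLike.re (z : 𝕜) • v := by
  have hz : ((RCLike.re (z : 𝕜) : ℝ) : 𝕜) = z :=
    RCLike.conj_eq_iff_re.1 (hA.conj_eigenvalue_eq_self z.2)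
  rw [mem_eigenspace_iff, RCLike.real_smul_eq_coe_smul (K := 𝕜), hz, ContinuousLinearMap.coe_coe]

theorem isInvariantUnder_eigenspace (hA : A ∈ symmetricCommutant 𝕜 f)
    (z : Eigenvalues (A : E →ₗ[𝕜] E)) :
    IsInvariantUnder f (eigenspace (A : E →ₗ[𝕜] E) z) := by
  intro i v hv
  rw [mem_eigenspace_iff_eq_re_smul hA.1] at hv ⊢
  rw [hA.2, hv, map_smul]

theorem mul_swap_eq_smul_of_isSymmetric {S T : E →L[𝕜] E} (hS : (S : E →ₗ[𝕜] E).IsSymmetric)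
    (hT : (T : E →ₗ[𝕜] E).IsSymmetric) {c : ℝ} (h : S * T = c • T) : T * S = c • T := by
  ext v
  refine ext_inner_right 𝕜 fun w => ?_
  calc inner 𝕜 (T (S v)) w = inner 𝕜 v (S (T w)) := (hT _ _).trans (hS _ _)
    _ = inner 𝕜 v ((c : 𝕜) • T w) := by
        rw [← RCLike.real_smul_eq_coe_smul, ← mul_apply_eq_comp, h, smul_apply]
    _ = inner 𝕜 ((c : 𝕜) • T v) w := by
        rw [inner_smul_real_right, inner_smul_real_left]
        exact congrArg _ (hT v w).symm
    _ = inner 𝕜 ((c • T) v) w := by rw [← RCLike.real_smul_eq_coe_smul, smul_apply]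

variable [FiniteDimensional 𝕜 E]

theorem exists_natDegree_minpoly_lt_add_smul_starProjection (hA : (A : E →ₗ[𝕜] E).IsSymmetric)
    {z : Eigenvalues (A : E →ₗ[𝕜] E)} {U : Submodule 𝕜 E} (hU0 : U ≠ ⊥)
    (hU : U < eigenspace (A : E →ₗ[𝕜] E) z) :
    ∃ ε : ℝ, (minpoly ℝ A).natDegree < (minpoly ℝ (A + ε • U.starProjection)).natDegree := by
  set W := eigenspace (A : E →ₗ[𝕜] E) z
  have : FiniteDimensional ℝ (E →L[𝕜] E) := FiniteDimensional.trans ℝ 𝕜 _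
  have mul_eq_smul {T : E →L[𝕜] E} (hT : ∀ v, T v ∈ W) : A * T = RCLike.re (z : 𝕜) • T :=
    ContinuousLinearMap.ext fun v => (mem_eigenspace_iff_eq_re_smul hA z).1 (hT v)
  have hAU : A * U.starProjection = RCLike.re (z : 𝕜) • U.starProjection :=
    mul_eq_smul fun v => hU.le (U.starProjection_apply_mem v)
  have hcompl : U.starProjection * (W.starProjection - U.starProjection) = 0 := by
    rw [mul_sub, U.isIdempotentElem_starProjection.eq, sub_eq_zero]
    exact Submodule.starProjection_comp_starProjection_of_le hU.le
  exact exists_natDegree_minpoly_lt_add_smul U.isIdempotentElem_starProjection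
    (by rwa [ne_eq, ← Submodule.starProjection_bot, Submodule.starProjection_inj])
    hAU (mul_swap_eq_smul_of_isSymmetric hA U.starProjection_isSymmetric hAU)
    (sub_ne_zero.2 (Submodule.starProjection_inj.not.2 hU.ne'))
    (mul_eq_smul fun v => W.sub_mem (W.starProjection_apply_mem v)
      (hU.le (U.starProjection_apply_mem v))) hcompl

theorem isIrreducibleUnder_eigenspace (hA : A ∈ symmetricCommutant 𝕜 f)
    (hmax : ∀ B ∈ symmetricCommutant 𝕜 f, (minpoly ℝ B).natDegree ≤ (minpoly ℝ A).natDegree)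
    (z : Eigenvalues (A : E →ₗ[𝕜] E)) :
    IsIrreducibleUnder f (eigenspace (A : E →ₗ[𝕜] E) z) := by
  refine ⟨⟨z.2, isInvariantUnder_eigenspace hA z⟩, fun U ⟨hU0, hU⟩ hUW => ?_⟩
  by_contra hWU
  obtain ⟨ε, hε⟩ := exists_natDegree_minpoly_lt_add_smul_starProjection hA.1 hU0
    (lt_of_le_not_ge hUW hWU)
  exact hε.not_ge (hmax _ (add_mem hA
    (Submodule.smul_mem _ ε hU.starProjection_mem_symmetricCommutant)))

theorem ae_forall_mem_span_natDegree_minpoly_le {κ : Type*} [Fintype κ] (Q : κ → E →L[𝕜] E) :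
    ∀ᵐ x : κ → ℝ, ∀ B ∈ Submodule.span ℝ (Set.range Q),
      (minpoly ℝ B).natDegree ≤ (minpoly ℝ (∑ l, x l • Q l)).natDegree := by
  have : FiniteDimensional ℝ (E →L[𝕜] E) := FiniteDimensional.trans ℝ 𝕜 _
  let : NormedAlgebra ℝ (E →L[𝕜] E) := { norm_smul_le := norm_smul_le }
  filter_upwards [ae_forall_natDegree_minpoly_le volume (Fintype.linearCombination ℝ Q)]
    with x hx B hB
  rw [← Fintype.range_linearCombination] at hB
  obtain ⟨y, rfl⟩ := hB
  exact hx y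

theorem mainTheorem2_general {𝕜 E : Type*} [RCLike 𝕜] [NormedAddCommGroup E]
    [InnerProductSpace 𝕜 E] [NormedSpace ℝ E] [IsScalarTower ℝ 𝕜 E] [FiniteDimensional 𝕜 E]
    {ι : Type*} (f : ι → E →ₗᵢ[ℝ] E) {κ : Type*} [Fintype κ] (Q : κ → E →L[𝕜] E)
    (hQ : Submodule.span ℝ (Set.range Q) = symmetricCommutant 𝕜 f)
    {Ω : Type*} [MeasurableSpace Ω] (P : Measure Ω) (r : κ → Ω → ℝ)
    (hr : ∀ l, AEMeasurable (r l) P)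
    (hlaw : P.map (fun x l => r l x) ≪ (volume : Measure (κ → ℝ))) :
    ∀ᵐ x ∂P, ∀ T : E →ₗ[𝕜] E, T = (∑ l, r l x • Q l : E →L[𝕜] E) →
      DirectSum.IsInternal (fun z : Eigenvalues T => eigenspace T z) ∧
      (∀ z z' : Eigenvalues T, z ≠ z' → eigenspace T z ⟂ eigenspace T z') ∧
      (∀ z : Eigenvalues T, IsIrreducibleUnder f (eigenspace T z)) ∧
      (∑ z : Eigenvalues T, (eigenspace T z).starProjection = 1) ∧
      (∀ z z' : Eigenvalues T, z ≠ z' →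
        (eigenspace T z).starProjection * (eigenspace T z').starProjection = 0) ∧
      (∀ (z : Eigenvalues T) (i : ι) (v : E),
        (eigenspace T z).starProjection (f i v) = f i ((eigenspace T z).starProjection v)) := by
  filter_upwards [ae_of_ae_map (aemeasurable_pi_lambda _ hr)
    (hlaw.ae_le (ae_forall_mem_span_natDegree_minpoly_le Q))] with x hmax T hT
  rw [hQ] at hmax
  have hA : ∑ l, r l x • Q l ∈ symmetricCommutant 𝕜 f := by
    rw [← hQ]
    exact sum_mem fun l _ => Submodule.smul_mem _ _ (Submodule.subset_span ⟨l, rfl⟩)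
  have hsymm : T.IsSymmetric := hT ▸ hA.1
  have hinternal := hsymm.direct_sum_isInternal
  have horth (z z' : Eigenvalues T) (h : z ≠ z') : eigenspace T z ⟂ eigenspace T z' :=
    hsymm.orthogonalFamily_eigenspaces'.isOrtho h
  have hirr (z : Eigenvalues T) : IsIrreducibleUnder f (eigenspace T z) := by
    subst hT
    exact isIrreducibleUnder_eigenspace hA hmax z
  refine ⟨hinternal, horth, hirr, ?_,
    fun z z' h => (horth z z' h).starProjection_comp_starProjection,
    fun z i => starProjection_map_of_forall_mem (f i) ((hirr z).prop.2 i)⟩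
  ext1 v
  rw [sum_apply]
  exact hsymm.orthogonalFamily_eigenspaces'.sum_projection_of_mem_iSup v
    (hinternal.submodule_iSup_eq_top ▸ Submodule.mem_top)

end Isometries

namespace Corep

theorem norm_kappa (d : ℕ) (ε : ℤˣ) (v : Carrier d) : ‖kappa d ε v‖ = ‖v‖ := by
  unfold kappa
  split_ifs
  · rfl
  · simp [conjugation, EuclideanSpace.norm_eq]

theorem norm_matOp_of_mem_unitaryGroup {d : ℕ} {A : Matrix (Fin d) (Fin d) ℂ}
    (hA : A ∈ Matrix.unitaryGroup (Fin d) ℂ) (v : Carrier d) : ‖matOp A v‖ = ‖v‖ :=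
  ContinuousLinearMap.norm_map_of_mem_unitary
    (Unitary.map_mem (Matrix.toEuclideanCLM (n := Fin d) (𝕜 := ℂ)) hA) v

namespace ProjCorep

variable {G : Type*} [Group G] {s : G →* ℤˣ} {ω : FactorSystem s} {d : ℕ}

/-- The operators `M(g)κ_{s(g)}` as real-linear isometries. -/
noncomputable def opIsometry (R : ProjCorep s ω d) (g : G) : Carrier d →ₗᵢ[ℝ] Carrier d where
  toLinearMap := R.op g
  norm_map' v := (norm_matOp_of_mem_unitaryGroup (R.M g).2 _).trans (norm_kappa d (s g) v)

theorem isIrreducibleComponent_iff (R : ProjCorep s ω d) (W : Submodule ℂ (Carrier d)) :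
    R.IsIrreducibleComponent W ↔ IsIrreducibleUnder R.opIsometry W := by
  constructor
  · rintro ⟨hW0, hW, hmin⟩
    exact ⟨⟨hW0, hW⟩, fun U ⟨hU0, hU⟩ hUW => ((hmin U hUW hU).resolve_left hU0).ge⟩
  · rintro ⟨⟨hW0, hW⟩, hmin⟩
    exact ⟨hW0, hW, fun U hUW hU =>
      or_iff_not_imp_left.2 fun hU0 => hUW.antisymm (hmin ⟨hU0, hU⟩ hUW)⟩

theorem toEuclideanCLM_mem_symmetricCommutant_iff (R : ProjCorep s ω d)
    {A : Matrix (Fin d) (Fin d) ℂ} :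
    Matrix.toEuclideanCLM (𝕜 := ℂ) A ∈ symmetricCommutant ℂ R.opIsometry ↔
      A ∈ R.hermitianCentralizer := by
  refine and_congr Matrix.isSymmetric_toEuclideanLin_iff (forall_congr' fun g => ?_)
  rw [LinearMap.ext_iff]
  rfl

theorem span_toEuclideanCLM_eq_symmetricCommutant (R : ProjCorep s ω d) {κ : Type*}
    {Q : κ → R.hermitianCentralizer} (hQ : Submodule.span ℝ (Set.range Q) = ⊤) :
    Submodule.span ℝ (Set.range fun l => Matrix.toEuclideanCLM (𝕜 := ℂ)
      (Q l : Matrix (Fin d) (Fin d) ℂ)) = symmetricCommutant ℂ R.opIsometry := by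
  let Φ : Matrix (Fin d) (Fin d) ℂ →ₗ[ℝ] Carrier d →L[ℂ] Carrier d :=
    (Matrix.toEuclideanCLM (n := Fin d) (𝕜 := ℂ)).toAlgEquiv.toLinearMap.restrictScalars ℝ
  calc Submodule.span ℝ (Set.range fun l => Φ (Q l))
      = (Submodule.span ℝ (Set.range Q)).map (Φ ∘ₗ R.hermitianCentralizer.subtype) := by
        rw [Submodule.map_span, ← Set.range_comp]
        rfl
    _ = R.hermitianCentralizer.map Φ := by
        rw [hQ, Submodule.map_comp, Submodule.map_subtype_top]
    _ = symmetricCommutant ℂ R.opIsometry := by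
        ext T
        obtain ⟨A, rfl⟩ := EquivLike.surjective (Matrix.toEuclideanCLM (n := Fin d) (𝕜 := ℂ)) T
        rw [R.toEuclideanCLM_mem_symmetricCommutant_iff]
        exact (EquivLike.injective (Matrix.toEuclideanCLM (n := Fin d) (𝕜 := ℂ))).mem_set_image

end ProjCorep

end Corep

theorem mainTheorem2 {G : Type*} [Group G] (s : G →* ℤˣ) (ω : Corep.FactorSystem s) (d : ℕ)
    (R : Corep.ProjCorep s ω d)
    (m : ℕ) (Q : Module.Basis (Fin m) ℝ R.hermitianCentralizer)
    {Ω : Type*} [MeasurableSpace Ω] (P : Measure Ω) [IsProbabilityMeasure P]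
    (r : Fin m → Ω → ℝ) (hr : ∀ l, Measurable (r l))
    (hlaw : P.map (fun x l => r l x) ≪ (volume : Measure (Fin m → ℝ))) :
    ∀ᵐ x ∂P, ∀ A : Matrix (Fin d) (Fin d) ℂ,
      A = ∑ l, r l x • (Q l : Matrix (Fin d) (Fin d) ℂ) →
        -- the space is the internal, orthogonal direct sum of the eigenspaces
        DirectSum.IsInternal (fun z : Corep.Eigenvalue A => Corep.eigenspace A z) ∧
        (∀ z z' : Corep.Eigenvalue A, z ≠ z' → Corep.eigenspace A z ⟂ Corep.eigenspace A z') ∧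
        -- each eigenspace is an irreducible component
        (∀ z : Corep.Eigenvalue A, R.IsIrreducibleComponent (Corep.eigenspace A z)) ∧
        -- the eigenprojectors are a resolution of the identity commuting with the action
        (∑ z : Corep.Eigenvalue A, Corep.eigenprojector A z = 1) ∧
        (∀ z z' : Corep.Eigenvalue A, z ≠ z' →
          Corep.eigenprojector A z * Corep.eigenprojector A z' = 0) ∧
        (∀ (z : Corep.Eigenvalue A) (g : G) (v : Corep.Carrier d),
          Corep.eigenprojector A z (R.op g v) = R.op g (Corep.eigenprojector A z v)) := by
  filter_upwards [mainTheorem2_general R.opIsometry _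
    (R.span_toEuclideanCLM_eq_symmetricCommutant Q.span_eq) P r
    (fun l => (hr l).aemeasurable) hlaw] with x hx A hA
  obtain ⟨hinternal, horth, hirr, hproj⟩ := hx (Matrix.toEuclideanLin A) <| by
    rw [← Matrix.coe_toEuclideanCLM_eq_toEuclideanLin]
    simp only [hA, map_sum, ← Complex.coe_smul, map_smul]
  exact ⟨hinternal, horth, fun z => (R.isIrreducibleComponent_iff _).2 (hirr z), hproj⟩
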